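/- Let $p$ be a prime number and let $(A,+,\circ)$ be a left brace which is an $\mathbb F_p$-brace: $(A,+)$ is an $\mathbb F_p$-vector space, $(A,\circ)$ is a group, $a\circ(b+c)+a=a\circ b+a\circ c$ for all $a,b,c\in A$, and, with $a*b=a\circ b-a-b$, one has $a*(\alpha b)=\alpha(a*b)$ for all $a,b\in A$, $\alpha\in\mathbb F_p$. Put $A^{[1]}=A$ and $A^{[i+1]}=\sum_{j=1}^{i}A^{[j]}*A^{[i+1-j]}$, where $X*Y$ denotes the additive subgroup generated by all $x*y$ with $x\in X$, $y\in Y$. Assume that $A$ is strongly nilpotent of index $k$, i.e. $k\ge 1$ is the least integer with $A^{[k]}=0$, and that $2^k<p$. Define $$a\cdot b=-\sum_{i=0}^{p-2}2^{-i}\bigl((2^i a)*b\bigr)\qquad(a,b\in A),$$ where $2^ia$ is the sum of $2^i$ copies of $a$ and $2^{-i}$ is the inverse of $2^i$ in $\mathbb F_p$. Then $(A,+,\cdot)$ is a pre-Lie algebra over $\mathbb F_p$, that is, $\cdot$ is $\mathbb F_p$-bilinear and $(x\cdot y)\cdot z-x\cdot(y\cdot z)=(y\cdot x)\cdot z-y\cdot(x\cdot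 z)$ for all $x,y,z\in A$. It is nilpotent of index $k$: $k$ is the least positive integer such that all products of $k$ elements, with any distribution of brackets, are zero. Moreover $(A,\circ)$ is the group of flows of this pre-Lie algebra: writing $L_a(b)=a\cdot b$ and $$e^{L_a}(b)=\sum_{i=0}^{k-1}\frac1{i!}L_a^i(b),\qquad W(a)=e^{L_a}(1)-1=\sum_{i=0}^{k-1}\frac1{(i+1)!}L_a^{i}(a)$$ (with a formal unit $1$; all further terms of these series vanish), the map $W:A\to A$ is bijective and, with $\Omega=W^{-1}$, $$a\circ b=a+e^{L_{\Omega(a)}}(b)\qquad\text{for all }a,b\in A.$$ In particular, the brace $(A,+,\circ)$ is recovered from the pre-Lie algebra $(A,+,\cdot)$. -/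

import Mathlib

open scoped Nat

/-- A left brace with additive group `(A, +)`: a second group structure `(A, ∘)` such that
`a ∘ (b + c) + a = a ∘ b + a ∘ c`. -/
structure LeftBrace (A : Type*) [AddCommGroup A] where
  /-- The group `(A, ∘)`. -/
  circGroup : Group A
  circ_add' : ∀ a b c : A,
    circGroup.mul a (b + c) + a = circGroup.mul a b + circGroup.mul a c

namespace LeftBrace

variable {A : Type*} [AddCommGroup A]

/-- The operation `a ∘ b`. -/
def circ (B : LeftBrace A) (a b : A) : A := B.circGroup.mul a b

/-- The operation `a * b = a ∘ b - a - b`. -/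
def star (B : LeftBrace A) (a b : A) : A := B.circ a b - a - b

/-- `B` is an `F`-brace: `(A, +)` is an `F`-vector space and `a * (α b) = α (a * b)`. -/
def IsFBrace (F : Type*) [Field F] [Module F A] (B : LeftBrace A) : Prop :=
  ∀ (α : F) (a b : A), B.star a (α • b) = α • B.star a b

/-- The chain `A^{[1]} = A`, `A^{[i+1]} = ∑_{j=1}^{i} A^{[j]} * A^{[i+1-j]}`, where `X * Y` is the
additive subgroup generated by all `x * y` with `x ∈ X`, `y ∈ Y`. In the last clause `i = n + 1`
and the summation index is `j + 1`. The value at `0` is a convention and is never used. -/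
def strongPow (B : LeftBrace A) : ℕ → AddSubgroup A
  | 0 => ⊤
  | 1 => ⊤
  | n + 2 => ⨆ j : Fin (n + 1), AddSubgroup.closure
      {x | ∃ a ∈ B.strongPow (j.1 + 1), ∃ b ∈ B.strongPow (n + 1 - j.1), x = B.star a b}
termination_by n => n
decreasing_by all_goals omega

/-- `B` is strongly nilpotent of index `k`: `k ≥ 1` is least with `A^{[k]} = 0`. -/
def IsStronglyNilpotentOfIndex (B : LeftBrace A) (k : ℕ) : Prop :=
  IsLeast {n : ℕ | 1 ≤ n ∧ B.strongPow n = ⊥} k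

/-- The operation `a · b = - ∑_{i=0}^{p-2} 2^{-i} ((2^i a) * b)`, where `2^i a` is the sum of `2^i`
copies of `a` and `2^{-i}` is the inverse of `2^i` in the field with `p` elements. -/
def dot (p : ℕ) [Fact p.Prime] [Module (ZMod p) A] (B : LeftBrace A) (a b : A) : A :=
  -∑ i ∈ Finset.range (p - 1), ((2 : ZMod p) ^ i)⁻¹ • B.star ((2 ^ i : ℕ) • a) b

end LeftBrace

/-- A (left) pre-Lie algebra structure on the `F`-vector space `A`: a bilinear product with
`(x y) z - x (y z) = (y x) z - y (x z)`. -/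
structure PreLieStructure (F A : Type*) [Field F] [AddCommGroup A] [Module F A] where
  mul : A →ₗ[F] A →ₗ[F] A
  symm' : ∀ x y z : A,
    mul (mul x y) z - mul x (mul y z) = mul (mul y x) z - mul y (mul x z)

namespace PreLieStructure

variable {F A : Type*} [Field F] [AddCommGroup A] [Module F A]

/-- The same data as one of Mathlib's left pre-Lie rings, with the given addition. -/
abbrev toLeftPreLieRing (P : PreLieStructure F A) : LeftPreLieRing A :=
  { (inferInstance : AddCommGroup A) with
    mul := fun a b => P.mul a b
    left_distrib := fun a b c => map_add (P.mul a) b c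
    right_distrib := fun a b c => LinearMap.map_add₂ P.mul a b c
    zero_mul := fun a => LinearMap.map_zero₂ P.mul a
    mul_zero := fun a => map_zero (P.mul a)
    assoc_symm' := fun x y z => P.symm' x y z }

/-- `P.IsProduct n x`: the element `x` is a product of `n` elements of `A` (with some distribution
of brackets) in the pre-Lie algebra. -/
inductive IsProduct (P : PreLieStructure F A) : ℕ → A → Prop
  | single (a : A) : IsProduct P 1 a
  | mul {m n : ℕ} {a b : A} (ha : IsProduct P m a) (hb : IsProduct P n b) :
      IsProduct P (m + n) (P.mul a b)

/-- The pre-Lie algebra is nilpotent of index `k`: `k ≥ 1` is least such that all products of `k`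
elements, with any distribution of brackets, are zero. -/
def IsNilpotentOfIndex (P : PreLieStructure F A) (k : ℕ) : Prop :=
  IsLeast {n : ℕ | 1 ≤ n ∧ ∀ x, P.IsProduct n x → x = 0} k

/-- `e^{L_a}(b) = b + a · b + (1/2!) a · (a · b) + ⋯`, where `L_a(b) = a · b`. All omitted terms are
products of more than `k` elements. -/
def expL (P : PreLieStructure F A) (k : ℕ) (a b : A) : A :=
  ∑ i ∈ Finset.range k, ((i ! : ℕ) : F)⁻¹ • ((P.mul a) ^ i) b

/-- `W(a) = e^{L_a}(1) - 1 = a + (1/2!) a · a + (1/3!) a · (a · a) + ⋯`, with the formal unit `1`.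
All omitted terms are products of more than `k` elements. -/
def flowW (P : PreLieStructure F A) (k : ℕ) (a : A) : A :=
  ∑ i ∈ Finset.range k, (((i + 1)! : ℕ) : F)⁻¹ • ((P.mul a) ^ i) a

/-- `circ` is the multiplication of the group of flows of the pre-Lie algebra `P` of nilpotency
index `k`: the map `W` is bijective and, with `Ω` its inverse, `a ∘ b = a + e^{L_{Ω(a)}}(b)`. -/
def IsFlowMultiplication (P : PreLieStructure F A) (k : ℕ) (circ : A → A → A) : Prop :=
  ∃ Ω : A → A, Function.LeftInverse Ω (P.flowW k) ∧ Function.RightInverse Ω (P.flowW k) ∧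
    ∀ a b : A, circ a b = a + P.expL k (Ω a) b

end PreLieStructure

/-! The group `(A, ∘)` acts faithfully on `A ⊕ F_p 1` by the operators `1 + aff a`, which send the
formal unit `1` to `1 + a`. The filtration by the `A^{[i]}` forces `(aff a)^k = 0` with `k < p`, so
logarithms make sense over `F_p`. `logOp` is the logarithm, and `logPoint`, its value at the unit,
is Ω. It differs from the identity by a contraction of the filtration, so it is bijective.
`tangentOp x`, the logarithm belonging to Ω⁻¹(x), generates the one-parameter subgroup with tangent
vector `x`, and `x · y` is `tangentOp x` applied to `y`.

The crux is that `tangentOp` is additive and takes `x · y - y · x` to the commutator, as for a Lie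
group. Differential calculus is replaced by `curves`, polynomials in `t` that have degree below `k`
by nilpotency. By `exists_aff_curve` and `coeff_eq_tangentOp`, the leading term of a curve in the
group is `tangentOp` of its value at the unit. Products and commutators of exponentials then give
additivity and the pre-Lie identity. Also `(t a) * b` is a polynomial in `t` with linear term `a ·
b`, which the sum over powers of two extracts (`ZMod.neg_sum_two_pow`). The flow formulas are `1 +
aff a = exp (logOp a)` read on `b` and on the unit; they also show that both filtrations agree,
hence both indices. -/

/-! ### Polynomial functions, exponential and logarithm over `F_p`. -/

section ZModPolynomial

open Polynomial

variable {p : ℕ} [Fact p.Prime]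

/-- A polynomial map `ZMod p → V` of degree less than `p` determines its coefficients. -/
theorem ZMod.sum_pow_smul_injective {V : Type*} [AddCommGroup V] [Module (ZMod p) V] {k : ℕ}
    (hk : k ≤ p) {c d : ℕ → V}
    (h : ∀ t : ZMod p, ∑ j ∈ Finset.range k, t ^ j • c j = ∑ j ∈ Finset.range k, t ^ j • d j)
    {j : ℕ} (hj : j < k) : c j = d j := by
  -- A linear functional reduces to a scalar polynomial of degree below `p` vanishing at all `p`
  -- points.
  rw [← sub_eq_zero, ← Module.forall_dual_apply_eq_zero_iff (ZMod p)]
  intro l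
  set q : (ZMod p)[X] := ∑ i ∈ Finset.range k, monomial i (l (c i - d i)) with hq
  have hdeg : q.degree < (Finset.univ : Finset (ZMod p)).card := by
    rw [Finset.card_univ, ZMod.card]
    refine lt_of_lt_of_le ((degree_lt_iff_coeff_zero q k).2 fun m hm => ?_) (by exact_mod_cast hk)
    simp [hq, coeff_monomial, not_lt.2 hm]
  have h0 : q = 0 := by
    refine eq_zero_of_degree_lt_of_eval_finset_eq_zero Finset.univ hdeg fun t _ => ?_
    have := congrArg l (sub_eq_zero.2 (h t))
    rw [← Finset.sum_sub_distrib, map_sum, map_zero] at this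
    rw [hq, eval_finsetSum, ← this]
    refine Finset.sum_congr rfl fun i _ => ?_
    rw [eval_monomial, ← smul_sub, map_smul, smul_eq_mul, mul_comm]
  have := congrArg (fun r => r.coeff j) h0
  simpa [hq, finsetSum_coeff, coeff_monomial, hj] using this

/-- A polynomial one-parameter family `∑ t ^ j C_j` which is multiplicative in `t` is the
exponential family of `C_1`. -/
theorem ZMod.oneParameter_coeff {R : Type*} [Ring R] [Algebra (ZMod p) R] {k : ℕ} (hk : k < p)
    {C : ℕ → R} (h0 : C 0 = 1) (hC : ∀ j, k ≤ j → C j = 0)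
    (hmul : ∀ s t : ZMod p, ∑ j ∈ Finset.range k, (s + t) ^ j • C j =
      (∑ j ∈ Finset.range k, s ^ j • C j) * ∑ j ∈ Finset.range k, t ^ j • C j) (j : ℕ) (hj : j < k) :
    C j = ((j ! : ℕ) : ZMod p)⁻¹ • C 1 ^ j := by
  -- The derivative of `hmul` in `t` at `0`: the coefficients of `t ^ 1` on both sides are compared.
  have key : ∀ s : ZMod p, ∑ j ∈ Finset.range k, s ^ j • (((j + 1 : ℕ) : ZMod p) • C (j + 1)) =
      ∑ j ∈ Finset.range k, s ^ j • (C j * C 1) := by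
    intro s
    rcases Nat.lt_or_ge 1 k with h1 | h1
    swap
    · rw [Finset.sum_eq_zero, Finset.sum_eq_zero]
      · intro i _; rw [hC 1 h1, mul_zero, smul_zero]
      · intro i _; rw [hC (i + 1) (by omega), smul_zero, smul_zero]
    have hexp : ∀ t : ZMod p, ∑ i ∈ Finset.range k,
        t ^ i • (∑ j ∈ Finset.range k, (s ^ (j - i) * ((j.choose i : ℕ) : ZMod p)) • C j) =
        ∑ i ∈ Finset.range k, t ^ i • ((∑ j ∈ Finset.range k, s ^ j • C j) * C i) := by
      intro t
      have h2 := hmul s t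
      rw [Finset.mul_sum] at h2
      simp only [mul_smul_comm] at h2
      rw [← h2]
      simp only [Finset.smul_sum, smul_smul]
      rw [Finset.sum_comm]
      refine Finset.sum_congr rfl fun j hj => ?_
      rw [← Finset.sum_smul, add_comm s t, add_pow]
      congr 1
      have hj' := Finset.mem_range.1 hj
      symm
      refine (Finset.sum_subset (Finset.range_subset_range.2 (Nat.succ_le_of_lt hj'))
        fun i _ hi => ?_).trans (Finset.sum_congr rfl fun i _ => by ring)
      rw [Nat.choose_eq_zero_of_lt (by simpa using hi)]
      simp
    have h3 := ZMod.sum_pow_smul_injective hk.le hexp h1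
    rw [Finset.sum_mul] at h3
    simp only [smul_mul_assoc] at h3
    rw [← h3]
    obtain ⟨n, rfl⟩ : ∃ n, k = n + 1 := ⟨k - 1, by omega⟩
    rw [Finset.sum_range_succ, Finset.sum_range_succ', hC (n + 1) le_rfl]
    simp [smul_smul]
  induction j with
  | zero => simp [h0]
  | succ j ih =>
    have h4 := ZMod.sum_pow_smul_injective hk.le key (Nat.lt_of_succ_lt hj)
    rw [ih (Nat.lt_of_succ_lt hj), smul_mul_assoc, ← pow_succ] at h4
    have hne : ((j + 1 : ℕ) : ZMod p) ≠ 0 := by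
      rw [Ne, ZMod.natCast_eq_zero_iff]
      exact fun h => absurd (Nat.le_of_dvd (by omega) h) (by omega)
    rw [Nat.factorial_succ, Nat.cast_mul, mul_inv, ← smul_smul, ← h4, inv_smul_smul₀ hne]

/-- The coefficients of the logarithm: the linear coefficients of the binomial polynomials. -/
noncomputable def ZMod.logCoeff (p : ℕ) [Fact p.Prime] (i : ℕ) : ZMod p :=
  ((i ! : ℕ) : ZMod p)⁻¹ * (descPochhammer (ZMod p) i).coeff 1

theorem ZMod.logCoeff_zero : ZMod.logCoeff p 0 = 0 := by
  simp [ZMod.logCoeff, coeff_one]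

theorem ZMod.logCoeff_one : ZMod.logCoeff p 1 = 1 := by
  simp [ZMod.logCoeff]

/-- The truncated exponential of the truncated logarithm: powers of `1 + M`. -/
theorem ZMod.one_add_pow_eq_exp {R : Type*} [Ring R] [Algebra (ZMod p) R] {k : ℕ} (hk : k < p)
    (hk0 : 0 < k) {M : R} (hM : M ^ k = 0) (n : ℕ) :
    (1 + M) ^ n = ∑ j ∈ Finset.range k, (n : ZMod p) ^ j • ((j ! : ℕ) : ZMod p)⁻¹ •
      (∑ i ∈ Finset.range k, ZMod.logCoeff p i • M ^ i) ^ j := by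
  -- The binomial coefficient `n.choose i` is a polynomial in `n`; `C j` collects the coefficients
  -- of `n ^ j`, so `C 1` is the logarithm.
  set C : ℕ → R := fun j => ∑ i ∈ Finset.range k,
    (((i ! : ℕ) : ZMod p)⁻¹ * (descPochhammer (ZMod p) i).coeff j) • M ^ i with hCdef
  have hpow : ∀ n : ℕ, (1 + M) ^ n = ∑ j ∈ Finset.range k, (n : ZMod p) ^ j • C j := by
    intro n
    simp only [hCdef, Finset.smul_sum, smul_smul]
    rw [Finset.sum_comm]
    have h1 : (1 + M) ^ n = ∑ i ∈ Finset.range k, ((n.choose i : ℕ) : ZMod p) • M ^ i := by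
      have e1 : (1 + M) ^ n = ∑ i ∈ Finset.range (n + k + 1), ((n.choose i : ℕ) : ZMod p) • M ^ i := by
        rw [add_comm 1 M, (Commute.one_right M).add_pow]
        refine (Finset.sum_congr rfl fun i _ => ?_).trans
          (Finset.sum_subset (Finset.range_subset_range.2 (by omega : n + 1 ≤ n + k + 1))
            fun i _ hi => ?_)
        · rw [one_pow, mul_one, Nat.cast_smul_eq_nsmul, nsmul_eq_mul, Nat.cast_comm]
        · rw [Nat.choose_eq_zero_of_lt (by simpa using hi), Nat.cast_zero, zero_smul]
      rw [e1]
      symm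
      refine Finset.sum_subset (Finset.range_subset_range.2 (by omega)) fun i _ hi => ?_
      rw [pow_eq_zero_of_le (by simpa using hi) hM, smul_zero]
    rw [h1]
    refine Finset.sum_congr rfl fun i hi => ?_
    have hi' := Finset.mem_range.1 hi
    rw [← Finset.sum_smul]
    congr 1
    have h2 := descPochhammer_eval_eq_descFactorial (ZMod p) n i
    rw [eval_eq_sum_range' (n := k) (by rw [descPochhammer_natDegree]; exact hi')] at h2
    have hne : ((i ! : ℕ) : ZMod p) ≠ 0 := by
      rw [Ne, ZMod.natCast_eq_zero_iff, (Fact.out : p.Prime).dvd_factorial]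
      omega
    rw [Nat.descFactorial_eq_factorial_mul_choose, Nat.cast_mul] at h2
    rw [← mul_right_inj' hne, ← h2, Finset.mul_sum]
    refine Finset.sum_congr rfl fun j _ => ?_
    field_simp
  have hC0 : C 0 = 1 := by
    have := hpow 0
    rw [Finset.sum_eq_single_of_mem 0 (Finset.mem_range.2 hk0)] at this
    · simpa using this.symm
    · intro j _ hj; simp [hj]
  have hCk : ∀ j, k ≤ j → C j = 0 := by
    intro j hj
    refine Finset.sum_eq_zero fun i hi => ?_
    have hi' := Finset.mem_range.1 hi
    rw [coeff_eq_zero_of_natDegree_lt (by rw [descPochhammer_natDegree]; omega), mul_zero, zero_smul]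
  have hmul : ∀ s t : ZMod p, ∑ j ∈ Finset.range k, (s + t) ^ j • C j =
      (∑ j ∈ Finset.range k, s ^ j • C j) * ∑ j ∈ Finset.range k, t ^ j • C j := by
    intro s t
    -- Every scalar is the class of a natural number, so `pow_add` gives multiplicativity on all of
    -- `F_p`.
    have h := hpow (s.val + t.val)
    rw [pow_add, hpow, hpow] at h
    simpa using h.symm
  rw [hpow n]
  refine Finset.sum_congr rfl fun j hj => ?_
  rw [ZMod.oneParameter_coeff hk hC0 hCk hmul j (Finset.mem_range.1 hj)]
  rfl

end ZModPolynomial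

/-! ### Brace identities and the filtration by `A^{[i]}`. -/

namespace LeftBrace

section Basic

variable {A : Type*} [AddCommGroup A] (B : LeftBrace A)

theorem circ_eq (a b : A) : B.circ a b = a + b + B.star a b := by
  rw [star]; abel

theorem star_add (a b c : A) : B.star a (b + c) = B.star a b + B.star a c := by
  have h : B.circ a (b + c) + a = B.circ a b + B.circ a c := B.circ_add' a b c
  simp only [star]
  rw [eq_sub_of_add_eq h]; abel

/-- The map `b ↦ a * b`. -/
def starHom (a : A) : A →+ A := AddMonoidHom.mk' (B.star a) (B.star_add a)

theorem starHom_apply (a b : A) : B.starHom a b = B.star a b := rfl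

theorem circ_assoc (a b c : A) : B.circ (B.circ a b) c = B.circ a (B.circ b c) :=
  @mul_assoc A B.circGroup.toSemigroup a b c

theorem circ_zero (a : A) : B.circ a 0 = a := by
  have h := map_zero (B.starHom a)
  rw [starHom_apply] at h
  rw [circ_eq, h]; abel

theorem circGroup_one : B.circGroup.one = 0 :=
  (B.circ_zero B.circGroup.one).symm.trans (@one_mul A B.circGroup.toMulOneClass 0)

theorem zero_circ (a : A) : B.circ 0 a = a := by
  rw [← B.circGroup_one]
  exact @one_mul A B.circGroup.toMulOneClass a

theorem zero_star (a : A) : B.star 0 a = 0 := by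
  rw [star, zero_circ]; abel

theorem exists_circ_eq (a b : A) : ∃ h, B.circ a h = b := by
  let := B.circGroup
  exact ⟨a⁻¹ * b, mul_inv_cancel_left a b⟩

/-- Associativity of `∘`, in the form that `a ↦ 1 + starHom a` is multiplicative. -/
theorem circ_star (a b c : A) :
    B.star (B.circ a b) c = B.star a c + B.star b c + B.star a (B.star b c) := by
  have h := B.circ_assoc a b c
  rw [B.circ_eq (B.circ a b) c, B.circ_eq b c, B.circ_eq a (b + c + B.star b c), star_add,
    star_add, B.circ_eq a b] at h
  rw [B.circ_eq a b]
  have h2 := eq_sub_of_add_eq' h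
  rw [h2]; abel

theorem star_mem_strongPow {i j : ℕ} (hi : 1 ≤ i) (hj : 1 ≤ j) {a b : A}
    (ha : a ∈ B.strongPow i) (hb : b ∈ B.strongPow j) : B.star a b ∈ B.strongPow (i + j) := by
  obtain ⟨i, rfl⟩ := Nat.exists_eq_add_of_le' hi
  obtain ⟨j, rfl⟩ := Nat.exists_eq_add_of_le' hj
  rw [show i + 1 + (j + 1) = (i + j) + 2 by ring, strongPow]
  refine AddSubgroup.mem_iSup_of_mem (⟨i, by omega⟩ : Fin (i + j + 1))
    (AddSubgroup.subset_closure ⟨a, ha, b, ?_, rfl⟩)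
  rwa [show i + j + 1 - i = j + 1 by omega]

theorem strongPow_le_of_star_mem {n : ℕ} (hn : 2 ≤ n) {S : AddSubgroup A}
    (h : ∀ i j, 1 ≤ i → 1 ≤ j → i + j = n → ∀ a ∈ B.strongPow i, ∀ b ∈ B.strongPow j,
      B.star a b ∈ S) : B.strongPow n ≤ S := by
  obtain ⟨n, rfl⟩ := Nat.exists_eq_add_of_le' hn
  rw [strongPow]
  refine iSup_le fun j => (AddSubgroup.closure_le _).2 ?_
  rintro _ ⟨a, ha, b, hb, rfl⟩
  have := j.2
  exact h _ _ (by omega) (by omega) (by omega) a ha b hb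

theorem strongPow_one : B.strongPow 1 = ⊤ := by rw [strongPow]

theorem strongPow_zero : B.strongPow 0 = ⊤ := by rw [strongPow]

/-- A generator of `A^{[n+1]}` with `n ≥ 2` has a factor of degree at least two, whose degree can be
lowered by induction. -/
theorem strongPow_succ_le (n : ℕ) : B.strongPow (n + 1) ≤ B.strongPow n := by
  induction n using Nat.strong_induction_on with
  | _ n ih =>
    rcases Nat.lt_or_ge n 2 with hn | hn
    · interval_cases n
      · rw [strongPow_zero]; exact le_top
      · rw [strongPow_one]; exact le_top
    refine B.strongPow_le_of_star_mem (by omega) fun i j hi hj hij a ha b hb => ?_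
    rcases Nat.lt_or_ge 1 i with h1 | h1
    · obtain ⟨i, rfl⟩ : ∃ i', i = i' + 1 := ⟨i - 1, by omega⟩
      have := B.star_mem_strongPow (by omega) hj (ih i (by omega) ha) hb
      rwa [show i + j = n by omega] at this
    · obtain ⟨j, rfl⟩ : ∃ j', j = j' + 1 := ⟨j - 1, by omega⟩
      have := B.star_mem_strongPow hi (by omega) ha (ih j (by omega) hb)
      rwa [show i + j = n by omega] at this

theorem strongPow_antitone : Antitone B.strongPow := antitone_nat_of_succ_le B.strongPow_succ_le

/-- An element lies in `A^{[i]}` if membership in each earlier term can be improved by one. -/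
theorem mem_strongPow_of_step {i : ℕ} {x : A}
    (h : ∀ j, 1 ≤ j → j < i → x ∈ B.strongPow j → x ∈ B.strongPow (j + 1)) :
    x ∈ B.strongPow i := by
  have : ∀ j ≤ i, x ∈ B.strongPow j := by
    intro j
    induction j with
    | zero => intro _; rw [strongPow_zero]; trivial
    | succ j ih =>
      intro hj
      rcases Nat.eq_zero_or_pos j with rfl | h0
      · rw [strongPow_one]; trivial
      · exact h j h0 (by omega) (ih (by omega))
  exact this i le_rfl

/-- A map which contracts the filtration by the `A^{[i]}` has a unique fixed point. -/
theorem existsUnique_fixedPoint {k : ℕ} (hk1 : 1 ≤ k) (hk : B.strongPow k = ⊥) (T : A → A)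
    (hT : ∀ i, 1 ≤ i → ∀ x y, x - y ∈ B.strongPow i → T x - T y ∈ B.strongPow (i + 1)) :
    ∃! x, T x = x := by
  refine ⟨T^[k - 1] 0, ?_, fun y hy => ?_⟩
  · have h : ∀ n, T^[n] (T 0) - T^[n] 0 ∈ B.strongPow (n + 1) := by
      intro n
      induction n with
      | zero => rw [strongPow_one]; trivial
      | succ n ih =>
        rw [Function.iterate_succ_apply', Function.iterate_succ_apply']
        exact hT _ (by omega) _ _ ih
    have h1 := h (k - 1)
    rw [show k - 1 + 1 = k by omega, hk, AddSubgroup.mem_bot, sub_eq_zero] at h1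
    simp only
    rw [← Function.iterate_succ_apply' T, Function.iterate_succ_apply, h1]
  · have h : ∀ n, y - T^[n] 0 ∈ B.strongPow (n + 1) := by
      intro n
      induction n with
      | zero => rw [strongPow_one]; trivial
      | succ n ih =>
        have := hT _ (by omega) _ _ ih
        rwa [Function.iterate_succ_apply', ← hy, hy] at *
    have h1 := h (k - 1)
    rwa [show k - 1 + 1 = k by omega, hk, AddSubgroup.mem_bot, sub_eq_zero] at h1

end Basic

/-! ### The affine representation and operators raising the filtration degree. -/

section Affine

variable {A : Type*} [AddCommGroup A] (p : ℕ) [Fact p.Prime] [Module (ZMod p) A] (B : LeftBrace A)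

/-- The operator `(x, s) ↦ (a * x + s a, 0)` on `A ⊕ F_p 1`; adding the identity gives the affine
action of `(A, ∘)` on `A`. -/
def aff (a : A) : Module.End (ZMod p) (A × ZMod p) :=
  LinearMap.inl (ZMod p) A (ZMod p) ∘ₗ
    ((B.starHom a).toZModLinearMap p).coprod (LinearMap.toSpanSingleton (ZMod p) A a)

theorem aff_apply (a : A) (x : A × ZMod p) : B.aff p a x = (B.star a x.1 + x.2 • a, 0) := rfl

theorem one_add_aff_circ (a b : A) :
    1 + B.aff p (B.circ a b) = (1 + B.aff p a) * (1 + B.aff p b) := by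
  refine LinearMap.ext fun x => ?_
  rw [add_mul, one_mul, mul_add, mul_one]
  simp only [LinearMap.add_apply, Module.End.mul_apply, aff_apply, circ_star, Module.End.one_apply]
  refine Prod.ext ?_ (by simp)
  -- Additive maps of `F_p`-vector spaces are linear.
  have h : B.star a (x.2 • b) = x.2 • B.star a b :=
    map_smul ((B.starHom a).toZModLinearMap p) x.2 b
  simp only [Prod.fst_add, zero_smul, add_zero, star_add, h, B.circ_eq a b, smul_add]
  abel

theorem aff_zero : B.aff p 0 = 0 :=
  LinearMap.ext fun x => by rw [aff_apply, zero_star, smul_zero, add_zero]; rfl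

theorem aff_apply_one (a : A) : B.aff p a (0, 1) = (a, 0) := by
  have e : B.star a 0 = 0 := map_zero (B.starHom a)
  simp [aff_apply, e]

/-- The filtration of `A ⊕ F_p 1` with `A^{[i]}` in degree `i ≥ 1`. -/
def fil : ℕ → Submodule (ZMod p) (A × ZMod p)
  | 0 => ⊤
  | i + 1 => (AddSubgroup.toZModSubmodule p (B.strongPow (i + 1))).prod ⊥

theorem mem_fil {i : ℕ} (hi : 1 ≤ i) {x : A × ZMod p} :
    x ∈ B.fil p i ↔ x.1 ∈ B.strongPow i ∧ x.2 = 0 := by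
  obtain ⟨i, rfl⟩ := Nat.exists_eq_add_of_le' hi
  exact Iff.rfl

theorem fil_succ_le (i : ℕ) : B.fil p (i + 1) ≤ B.fil p i := by
  intro x hx
  rcases Nat.eq_zero_or_pos i with rfl | hi
  · trivial
  · rw [mem_fil p B (by omega)] at hx ⊢
    exact ⟨B.strongPow_succ_le i hx.1, hx.2⟩

theorem fil_antitone : Antitone (B.fil p) := antitone_nat_of_succ_le (B.fil_succ_le p)

/-- The operators raising the filtration degree by `j`. -/
def opFil (j : ℕ) : Submodule (ZMod p) (Module.End (ZMod p) (A × ZMod p)) where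
  carrier := {f | ∀ i, ∀ x ∈ B.fil p i, f x ∈ B.fil p (i + j)}
  add_mem' hf hg i x hx := add_mem (hf i x hx) (hg i x hx)
  zero_mem' i _ _ := zero_mem (B.fil p (i + j))
  smul_mem' c _ hf i x hx := Submodule.smul_mem _ c (hf i x hx)

variable {p}

theorem opFil_antitone : Antitone (B.opFil p) := fun _ _ h _ hf i x hx =>
  B.fil_antitone p (Nat.add_le_add_left h i) (hf i x hx)

theorem one_mem_opFil : (1 : Module.End (ZMod p) (A × ZMod p)) ∈ B.opFil p 0 := fun _ _ hx => hx

theorem mul_mem_opFil {i j : ℕ} {f g : Module.End (ZMod p) (A × ZMod p)} (hf : f ∈ B.opFil p i)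
    (hg : g ∈ B.opFil p j) : f * g ∈ B.opFil p (i + j) := fun n x hx => by
  have := hf _ _ (hg n x hx)
  rwa [add_assoc, add_comm j i] at this

theorem pow_mem_opFil {i : ℕ} {f : Module.End (ZMod p) (A × ZMod p)} (hf : f ∈ B.opFil p i)
    (n : ℕ) : f ^ n ∈ B.opFil p (i * n) := by
  induction n with
  | zero => exact B.one_mem_opFil
  | succ n ih => rw [pow_succ, mul_add, mul_one]; exact B.mul_mem_opFil ih hf

theorem pow_succ_mem_opFil {i : ℕ} {f : Module.End (ZMod p) (A × ZMod p)}
    (hf : f ∈ B.opFil p i) (n : ℕ) : f ^ (n + 1) ∈ B.opFil p i :=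
  B.opFil_antitone (Nat.le_mul_of_pos_right i n.succ_pos) (B.pow_mem_opFil hf (n + 1))

theorem eq_zero_of_mem_opFil {k : ℕ} (hk1 : 1 ≤ k) (hk : B.strongPow k = ⊥) {j : ℕ} (hj : k ≤ j)
    {f : Module.End (ZMod p) (A × ZMod p)} (hf : f ∈ B.opFil p j) : f = 0 := by
  refine LinearMap.ext fun x => ?_
  have h := B.opFil_antitone hj hf 0 x trivial
  rw [zero_add, mem_fil p B hk1, hk, AddSubgroup.mem_bot] at h
  exact Prod.ext h.1 h.2

theorem aff_mem_opFil {m : ℕ} (hm : 1 ≤ m) {a : A} (ha : a ∈ B.strongPow m) :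
    B.aff p a ∈ B.opFil p m := by
  intro i x hx
  rw [mem_fil p B (by omega), aff_apply]
  refine ⟨?_, rfl⟩
  rcases Nat.eq_zero_or_pos i with rfl | hi
  -- In degree `0` the unit contributes multiples of `a` itself, so the gain is exactly `m`.
  · have h1 : B.star a x.1 ∈ B.strongPow (m + 1) :=
      B.star_mem_strongPow hm le_rfl ha (by rw [strongPow_one]; trivial)
    rw [zero_add]
    exact add_mem (B.strongPow_succ_le m h1)
      (Submodule.smul_mem (AddSubgroup.toZModSubmodule p (B.strongPow m)) x.2 ha)
  · obtain ⟨h1, h2⟩ := (mem_fil p B hi).1 hx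
    rw [h2, zero_smul, add_zero, add_comm i m]
    exact B.star_mem_strongPow hm hi ha h1

theorem aff_mem_opFil_one (a : A) : B.aff p a ∈ B.opFil p 1 :=
  B.aff_mem_opFil le_rfl (by rw [strongPow_one]; trivial)

/-- As `aff` is not additive, differences go through the group: for `a = b ∘ x` one has `x = a - b -
b * x`, which pushes `x` into `A^{[i]}`, and `aff a - aff b = (1 + aff b) * aff x`. -/
theorem aff_sub_mem_opFil {i : ℕ} (hi : 1 ≤ i) {a b : A} (h : a - b ∈ B.strongPow i) :
    B.aff p a - B.aff p b ∈ B.opFil p i := by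
  obtain ⟨x, hx⟩ := B.exists_circ_eq b a
  have hxm : x ∈ B.strongPow i := by
    refine B.mem_strongPow_of_step fun j hj hji hxj => ?_
    have e : x = a - b - B.star b x := by rw [← hx, circ_eq]; abel
    have h1 := B.star_mem_strongPow le_rfl hj (a := b) (by rw [strongPow_one]; trivial) hxj
    rw [e]
    exact sub_mem (B.strongPow_antitone (by omega) h) (by rwa [add_comm] at h1)
  have e2 : B.aff p a - B.aff p b = (1 + B.aff p b) * B.aff p x := by
    have := B.one_add_aff_circ p b x
    rw [hx, mul_add, mul_one, add_assoc, add_right_inj] at this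
    rw [this, add_sub_cancel_left]
  rw [e2, add_mul, one_mul]
  have hx' := B.aff_mem_opFil (p := p) hi hxm
  exact add_mem hx' (B.opFil_antitone (by omega) (B.mul_mem_opFil (B.aff_mem_opFil_one b) hx'))

theorem exists_one_add_aff_pow (a : A) (n : ℕ) : ∃ u, 1 + B.aff p u = (1 + B.aff p a) ^ n := by
  induction n with
  | zero => exact ⟨0, by rw [aff_zero, add_zero, pow_zero]⟩
  | succ n ih =>
    obtain ⟨u, hu⟩ := ih
    exact ⟨B.circ u a, by rw [one_add_aff_circ, hu, pow_succ]⟩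

end Affine

end LeftBrace

/-! ### Logarithms and one-parameter subgroups. -/

/-- The truncated exponential `∑_{j<k} t ^ j N ^ j / j!`. -/
noncomputable def truncExp {p : ℕ} [Fact p.Prime] {R : Type*} [Ring R] [Algebra (ZMod p) R] (k : ℕ)
    (t : ZMod p) (N : R) : R :=
  ∑ j ∈ Finset.range k, t ^ j • ((j ! : ℕ) : ZMod p)⁻¹ • N ^ j

namespace LeftBrace

variable {A : Type*} [AddCommGroup A] {p : ℕ} [Fact p.Prime] [Module (ZMod p) A] (B : LeftBrace A)

variable (p) in
/-- The logarithm of `1 + aff a`. -/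
noncomputable def logOp (k : ℕ) (a : A) : Module.End (ZMod p) (A × ZMod p) :=
  B.aff p a + ∑ i ∈ Finset.range k, ZMod.logCoeff p (i + 2) • B.aff p a ^ (i + 2)

variable (p) in
/-- The logarithm map from the group `(A, ∘)` to `A`. -/
noncomputable def logPoint (k : ℕ) (a : A) : A := (B.logOp p k a (0, 1)).1

variable (p) in
/-- The operator on `A ⊕ F_p 1` generating the one-parameter subgroup of `(A, ∘)` with tangent
vector `a`. -/
noncomputable def tangentOp (k : ℕ) (a : A) : Module.End (ZMod p) (A × ZMod p) :=
  B.logOp p k (Function.invFun (B.logPoint p k) a)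

theorem logOp_mem_opFil (k : ℕ) {m : ℕ} (hm : 1 ≤ m) {a : A} (ha : a ∈ B.strongPow m) :
    B.logOp p k a ∈ B.opFil p m :=
  add_mem (B.aff_mem_opFil hm ha) (sum_mem fun i _ => Submodule.smul_mem _ _
    (B.pow_succ_mem_opFil (B.aff_mem_opFil hm ha) (i + 1)))

theorem apply_eq_of_mem_opFil_one {f : Module.End (ZMod p) (A × ZMod p)} (hf : f ∈ B.opFil p 1)
    (x : A × ZMod p) : f x = ((f x).1, 0) :=
  Prod.ext rfl ((B.mem_fil p le_rfl).1 (hf 0 x trivial)).2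

/-- `logPoint a - a` only involves powers of `aff a` from the second on; telescoping a difference of
such powers leaves an extra factor of degree one. -/
theorem logPoint_sub_mem (k : ℕ) {i : ℕ} (hi : 1 ≤ i) {a b : A} (h : a - b ∈ B.strongPow i) :
    (B.logPoint p k a - a) - (B.logPoint p k b - b) ∈ B.strongPow (i + 1) := by
  have hd := B.aff_sub_mem_opFil (p := p) hi h
  have h1 : ∀ n, B.aff p a ^ (n + 1) - B.aff p b ^ (n + 1) ∈ B.opFil p i := by
    intro n
    induction n with
    | zero => simpa using hd
    | succ n ih =>
      have e : B.aff p a ^ (n + 1 + 1) - B.aff p b ^ (n + 1 + 1) =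
          B.aff p a * (B.aff p a ^ (n + 1) - B.aff p b ^ (n + 1)) +
            (B.aff p a - B.aff p b) * B.aff p b ^ (n + 1) := by
        rw [pow_succ' (B.aff p a), pow_succ' (B.aff p b), mul_sub, sub_mul]; abel
      rw [e]
      exact add_mem
        (B.opFil_antitone (by omega) (B.mul_mem_opFil (B.aff_mem_opFil_one a) ih))
        (B.opFil_antitone (by omega) (B.mul_mem_opFil hd
          (B.pow_succ_mem_opFil (B.aff_mem_opFil_one b) n)))
  have h2 : ∀ n, B.aff p a ^ (n + 2) - B.aff p b ^ (n + 2) ∈ B.opFil p (i + 1) := by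
    intro n
    have e : B.aff p a ^ (n + 2) - B.aff p b ^ (n + 2) =
        B.aff p a * (B.aff p a ^ (n + 1) - B.aff p b ^ (n + 1)) +
          (B.aff p a - B.aff p b) * B.aff p b ^ (n + 1) := by
      rw [show n + 2 = (n + 1) + 1 from rfl, pow_succ' (B.aff p a), pow_succ' (B.aff p b), mul_sub,
        sub_mul]
      abel
    rw [e]
    exact add_mem
      (B.opFil_antitone (by omega) (B.mul_mem_opFil (B.aff_mem_opFil_one a) (h1 n)))
      (B.mul_mem_opFil hd (B.pow_succ_mem_opFil (B.aff_mem_opFil_one b) n))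
  have h3 : (B.logOp p k a - B.aff p a) - (B.logOp p k b - B.aff p b) ∈ B.opFil p (i + 1) := by
    simp only [logOp, add_sub_cancel_left]
    rw [← Finset.sum_sub_distrib]
    refine sum_mem fun n _ => ?_
    have := Submodule.smul_mem _ (ZMod.logCoeff p (n + 2)) (h2 n)
    rwa [smul_sub] at this
  have h4 := h3 0 (0, 1) trivial
  rw [B.mem_fil p (by omega), zero_add] at h4
  simpa [logPoint, LinearMap.sub_apply, aff_apply_one] using h4.1

theorem logPoint_zero (k : ℕ) : B.logPoint p k 0 = 0 := by
  simp [logPoint, logOp, aff_zero]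

theorem logPoint_bijective {k : ℕ} (hk1 : 1 ≤ k) (hk : B.strongPow k = ⊥) :
    Function.Bijective (B.logPoint p k) := by
  refine (Function.bijective_iff_existsUnique _).2 fun b => ?_
  -- The fixed points of this map are the solutions of `logPoint x = b`.
  have h := B.existsUnique_fixedPoint hk1 hk (fun x => b - (B.logPoint p k x - x)) ?_
  · refine (existsUnique_congr fun x => ?_).1 h
    constructor
    · intro h
      simpa using (sub_eq_iff_eq_add.1 h).symm
    · intro h
      rw [h]; abel
  · intro i hi x y hxy
    rw [sub_sub_sub_cancel_left, ← neg_sub, neg_mem_iff]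
    exact B.logPoint_sub_mem k hi hxy

theorem mem_strongPow_of_logPoint_mem (k : ℕ) {m : ℕ} {a : A}
    (h : B.logPoint p k a ∈ B.strongPow m) : a ∈ B.strongPow m := by
  refine B.mem_strongPow_of_step fun j hj hjm ha => ?_
  have h1 := B.logPoint_sub_mem (p := p) k hj (a := a) (b := 0) (by rwa [sub_zero])
  rw [logPoint_zero, sub_zero, sub_zero] at h1
  have := sub_mem (B.strongPow_antitone (show j + 1 ≤ m by omega) h) h1
  rwa [sub_sub_cancel] at this

section Tangent

variable {k : ℕ} (hk1 : 1 ≤ k) (hk : B.strongPow k = ⊥)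

include hk1 hk

theorem logPoint_invFun (a : A) :
    B.logPoint p k (Function.invFun (B.logPoint p k) a) = a :=
  Function.invFun_eq ((B.logPoint_bijective hk1 hk).2 a)

theorem tangentOp_logPoint (a : A) : B.tangentOp p k (B.logPoint p k a) = B.logOp p k a := by
  rw [tangentOp, Function.leftInverse_invFun (B.logPoint_bijective hk1 hk).1 a]

theorem tangentOp_mem_opFil {m : ℕ} (hm : 1 ≤ m) {a : A} (ha : a ∈ B.strongPow m) :
    B.tangentOp p k a ∈ B.opFil p m :=
  B.logOp_mem_opFil k hm (B.mem_strongPow_of_logPoint_mem (p := p) k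
    (by rwa [B.logPoint_invFun hk1 hk]))

theorem tangentOp_mem_opFil_one (a : A) : B.tangentOp p k a ∈ B.opFil p 1 :=
  B.tangentOp_mem_opFil hk1 hk le_rfl (by rw [strongPow_one]; trivial)

theorem tangentOp_one (a : A) : B.tangentOp p k a (0, 1) = (a, 0) := by
  rw [B.apply_eq_of_mem_opFil_one (B.tangentOp_mem_opFil_one hk1 hk a)]
  exact congrArg (fun x => (x, 0)) (B.logPoint_invFun hk1 hk a)

theorem tangentOp_zero : B.tangentOp p k 0 = 0 :=
  B.eq_zero_of_mem_opFil hk1 hk le_rfl (B.tangentOp_mem_opFil hk1 hk hk1 (zero_mem _))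

theorem one_add_aff_pow (hkp : k < p) (a : A) (n : ℕ) :
    (1 + B.aff p a) ^ n = truncExp k (n : ZMod p) (B.logOp p k a) := by
  have h0 : ∀ i, k ≤ i → B.aff p a ^ i = 0 := fun i hi =>
    B.eq_zero_of_mem_opFil hk1 hk (by omega) (B.pow_mem_opFil (B.aff_mem_opFil_one a) i)
  rw [ZMod.one_add_pow_eq_exp hkp hk1 (h0 k le_rfl) n, truncExp]
  have e : ∑ i ∈ Finset.range k, ZMod.logCoeff p i • B.aff p a ^ i = B.logOp p k a := by
    -- `logOp` runs up to the power `k + 1`; the powers `k` and `k + 1` vanish.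
    have e1 : ∑ i ∈ Finset.range (k + 2), ZMod.logCoeff p i • B.aff p a ^ i = B.logOp p k a := by
      rw [Finset.sum_range_succ', Finset.sum_range_succ', logOp, ZMod.logCoeff_zero,
        ZMod.logCoeff_one, zero_smul, add_zero, one_smul, pow_one, add_comm]
    rw [← e1, Finset.sum_range_succ, Finset.sum_range_succ, h0 k le_rfl, h0 (k + 1) (by omega)]
    simp
  rw [e]

/-- The exponential stays in the group because it is the `t.val`-th power of a group element. -/
theorem exists_one_add_aff_eq_truncExp (hkp : k < p) (a : A) (t : ZMod p) :
    ∃ u, 1 + B.aff p u = truncExp k t (B.tangentOp p k a) := by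
  obtain ⟨u, hu⟩ := B.exists_one_add_aff_pow (p := p) (Function.invFun (B.logPoint p k) a) t.val
  refine ⟨u, ?_⟩
  rw [hu, B.one_add_aff_pow hk1 hk hkp, ZMod.natCast_zmod_val]
  rfl

theorem truncExp_mul_truncExp_neg (hkp : k < p) (a : A) (t : ZMod p) :
    truncExp k t (B.tangentOp p k a) * truncExp k (-t) (B.tangentOp p k a) = 1 := by
  have h := B.one_add_aff_pow (p := p) hk1 hk hkp (Function.invFun (B.logPoint p k) a)
  have h1 := pow_add (1 + B.aff p (Function.invFun (B.logPoint p k) a)) t.val (-t).val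
  have h2 := h 0
  rw [h, h, h, Nat.cast_add, ZMod.natCast_zmod_val, ZMod.natCast_zmod_val, add_neg_cancel] at h1
  rw [pow_zero, Nat.cast_zero] at h2
  rw [h2]
  exact h1.symm

theorem one_add_aff_eq_truncExp (hkp : k < p) (a : A) :
    1 + B.aff p a = truncExp k (1 : ZMod p) (B.tangentOp p k (B.logPoint p k a)) := by
  rw [B.tangentOp_logPoint hk1 hk, ← pow_one (1 + _), B.one_add_aff_pow hk1 hk hkp, Nat.cast_one]

end Tangent

end LeftBrace

/-! ### Polynomials with noncommuting coefficients. -/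

open Polynomial in
/-- Evaluation of a polynomial with noncommuting coefficients at a central scalar. -/
noncomputable def evalScalar {p : ℕ} [Fact p.Prime] {R : Type*} [Ring R] [Algebra (ZMod p) R]
    (t : ZMod p) : R[X] →+* R :=
  eval₂RingHom' (RingHom.id R) (algebraMap (ZMod p) R t) fun a => (Algebra.commutes t a).symm

section ExpPoly

open Polynomial

variable {p : ℕ} [Fact p.Prime] {R : Type*} [Ring R] [Algebra (ZMod p) R]

theorem evalScalar_monomial (t : ZMod p) (n : ℕ) (a : R) :
    evalScalar t (monomial n a) = t ^ n • a := by
  change eval₂ _ _ _ = _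
  rw [eval₂_monomial, RingHom.id_apply, ← map_pow, Algebra.smul_def, Algebra.commutes]

theorem evalScalar_eq_sum (t : ZMod p) (q : R[X]) {k : ℕ} (hq : ∀ j, k ≤ j → q.coeff j = 0) :
    evalScalar t q = ∑ j ∈ Finset.range k, t ^ j • q.coeff j := by
  have h : q = ∑ j ∈ Finset.range k, monomial j (q.coeff j) := by
    ext n
    simp only [finsetSum_coeff, coeff_monomial]
    by_cases hn : n < k
    · rw [Finset.sum_eq_single_of_mem n (Finset.mem_range.2 hn)]
      · simp
      · intro b _ hb; simp [hb]
    · rw [hq n (not_lt.1 hn), Finset.sum_eq_zero]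
      intro b hb
      rw [if_neg]
      rintro rfl
      exact hn (Finset.mem_range.1 hb)
  conv_lhs => rw [h]
  rw [map_sum]
  exact Finset.sum_congr rfl fun j _ => evalScalar_monomial t j _

/-- The polynomial `∑_{j<k} s ^ j X ^ (m j) N ^ j / j!`. -/
noncomputable def expPoly (k m : ℕ) (s : ZMod p) (N : R) : R[X] :=
  ∑ j ∈ Finset.range k, monomial (m * j) (s ^ j • ((j ! : ℕ) : ZMod p)⁻¹ • N ^ j)

theorem evalScalar_expPoly (k m : ℕ) (s t : ZMod p) (N : R) :
    evalScalar t (expPoly k m s N) = truncExp k (s * t ^ m) N := by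
  rw [expPoly, map_sum, truncExp]
  refine Finset.sum_congr rfl fun j _ => ?_
  rw [evalScalar_monomial, smul_smul, mul_pow, ← pow_mul, mul_comm]

theorem coeff_expPoly_mul {k m : ℕ} (hm : 1 ≤ m) (s : ZMod p) {N : R} (hN : N ^ k = 0) (i : ℕ) :
    (expPoly k m s N).coeff (m * i) = s ^ i • ((i ! : ℕ) : ZMod p)⁻¹ • N ^ i := by
  simp only [expPoly, finsetSum_coeff, coeff_monomial]
  by_cases hi : i < k
  · rw [Finset.sum_eq_single_of_mem i (Finset.mem_range.2 hi), if_pos rfl]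
    intro b _ hb
    rw [if_neg fun h => hb (Nat.eq_of_mul_eq_mul_left hm h)]
  · rw [pow_eq_zero_of_le (not_lt.1 hi) hN, smul_zero, smul_zero, Finset.sum_eq_zero]
    intro b hb
    rw [if_neg]
    intro h
    rw [Nat.eq_of_mul_eq_mul_left hm h] at hb
    exact hi (Finset.mem_range.1 hb)

theorem coeff_expPoly_zero {k m : ℕ} (hm : 1 ≤ m) (s : ZMod p) {N : R} (hN : N ^ k = 0) :
    (expPoly k m s N).coeff 0 = 1 := by
  have := coeff_expPoly_mul hm s hN 0
  simpa using this

theorem coeff_expPoly_self {k m : ℕ} (hm : 1 ≤ m) (s : ZMod p) {N : R} (hN : N ^ k = 0) :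
    (expPoly k m s N).coeff m = s • N := by
  have := coeff_expPoly_mul hm s hN 1
  simpa using this

theorem coeff_expPoly_of_lt {k m : ℕ} (s : ZMod p) (N : R) {i : ℕ} (hi : 0 < i) (him : i < m) :
    (expPoly k m s N).coeff i = 0 := by
  simp only [expPoly, finsetSum_coeff, coeff_monomial]
  refine Finset.sum_eq_zero fun j _ => if_neg ?_
  rintro rfl
  rcases Nat.eq_zero_or_pos j with rfl | hj
  · exact absurd hi (by simp)
  · exact absurd him (not_lt.2 (Nat.le_mul_of_pos_right m hj))

theorem coeff_mul_of_lt {m : ℕ} {q r : R[X]} (h0 : q.coeff 0 = 1)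
    (h : ∀ i, 0 < i → i < m → q.coeff i = 0) {j : ℕ} (hj : j < m) :
    (q * r).coeff j = r.coeff j := by
  rw [coeff_mul, Finset.Nat.sum_antidiagonal_eq_sum_range_succ_mk, Finset.sum_range_succ',
    Finset.sum_eq_zero]
  · simp [h0]
  · intro i hi
    have := Finset.mem_range.1 hi
    simp only
    rw [h (i + 1) (by omega) (by omega), zero_mul]

/-- With `coeff_mul_of_lt`: a left factor `1 + O(t ^ m)` first acts in degree `m`, where it can
cancel a leading term. -/
theorem coeff_mul_self {m : ℕ} (hm : 1 ≤ m) {q r : R[X]} (h0 : q.coeff 0 = 1)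
    (h : ∀ i, 0 < i → i < m → q.coeff i = 0) :
    (q * r).coeff m = r.coeff m + q.coeff m * r.coeff 0 := by
  obtain ⟨m, rfl⟩ := Nat.exists_eq_add_of_le' hm
  rw [coeff_mul, Finset.Nat.sum_antidiagonal_eq_sum_range_succ_mk, Finset.sum_range_succ,
    Finset.sum_range_succ', Finset.sum_eq_zero]
  · simp [h0]
  · intro i hi
    have := Finset.mem_range.1 hi
    simp only
    rw [h (i + 1) (by omega) (by omega), zero_mul]

end ExpPoly

/-! ### Curves in the group and their leading terms. -/

namespace LeftBrace

open Polynomial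

variable {A : Type*} [AddCommGroup A] {p : ℕ} [Fact p.Prime] [Module (ZMod p) A] (B : LeftBrace A)

variable (p) in
/-- The polynomials in `t` whose coefficient of `t ^ j` raises the filtration degree by `j`. -/
def curves : Subring (Module.End (ZMod p) (A × ZMod p))[X] where
  carrier := {q | ∀ j, q.coeff j ∈ B.opFil p j}
  mul_mem' {q r} hq hr j := by
    rw [coeff_mul]
    refine sum_mem fun x hx => ?_
    rw [← Finset.HasAntidiagonal.mem_antidiagonal.1 hx]
    exact B.mul_mem_opFil (hq _) (hr _)
  one_mem' j := by
    rw [coeff_one]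
    split_ifs with h
    · rw [h]; exact B.one_mem_opFil
    · exact zero_mem _
  add_mem' hq hr j := by rw [coeff_add]; exact add_mem (hq j) (hr j)
  zero_mem' j := by rw [coeff_zero]; exact zero_mem _
  neg_mem' hq j := by rw [coeff_neg]; exact neg_mem (hq j)

theorem monomial_mem_curves {j : ℕ} {f : Module.End (ZMod p) (A × ZMod p)}
    (hf : f ∈ B.opFil p j) : monomial j f ∈ B.curves p := by
  intro i
  rw [coeff_monomial]
  split_ifs with h
  · rwa [← h]
  · exact zero_mem _

theorem expPoly_mem_curves (k : ℕ) {m : ℕ} (s : ZMod p) {N : Module.End (ZMod p) (A × ZMod p)}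
    (hN : N ∈ B.opFil p m) : expPoly k m s N ∈ B.curves p :=
  sum_mem fun j _ => B.monomial_mem_curves (Submodule.smul_mem _ _
    (Submodule.smul_mem _ _ (B.pow_mem_opFil hN j)))

theorem coeff_curve_eq_zero {k : ℕ} (hk1 : 1 ≤ k) (hk : B.strongPow k = ⊥)
    {q : (Module.End (ZMod p) (A × ZMod p))[X]} (hq : q ∈ B.curves p) (j : ℕ) (hj : k ≤ j) :
    q.coeff j = 0 :=
  B.eq_zero_of_mem_opFil hk1 hk hj (hq j)

theorem tangentOp_pow_eq_zero {k : ℕ} (hk1 : 1 ≤ k) (hk : B.strongPow k = ⊥) (a : A) :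
    B.tangentOp p k a ^ k = 0 :=
  B.eq_zero_of_mem_opFil hk1 hk (by omega) (B.pow_mem_opFil (B.tangentOp_mem_opFil_one hk1 hk a) k)

/-- Along a curve in `A` whose first possibly nonzero coefficient has index `m`, the affine
operators form a curve whose coefficient of index `m` is given by `tangentOp`. -/
theorem exists_aff_curve {k : ℕ} (hk1 : 1 ≤ k) (hk : B.strongPow k = ⊥) (hkp : k < p) (d : ℕ) :
    ∀ m, 1 ≤ m → k ≤ m + d → ∀ q ∈ B.curves p, ∀ f : ZMod p → A,
      (∀ t, evalScalar t q (0, 1) = (f t, 0)) → (∀ j < m, q.coeff j (0, 1) = 0) →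
      ∃ r ∈ B.curves p, (∀ t, evalScalar t r = B.aff p (f t)) ∧ (∀ j < m, r.coeff j = 0) ∧
        r.coeff m = B.tangentOp p k (q.coeff m (0, 1)).1 := by
  -- Descending induction on `m`: for `m ≥ k` the curve is zero at the unit, so `f = 0`.
  induction d with
  | zero =>
    intro m hm hkm q hq f hf h0
    have hz : ∀ j, q.coeff j (0, 1) = 0 := fun j => by
      rcases Nat.lt_or_ge j m with hj | hj
      · exact h0 j hj
      · rw [B.coeff_curve_eq_zero hk1 hk hq j (by omega), LinearMap.zero_apply]
    refine ⟨0, zero_mem _, fun t => ?_, fun j _ => coeff_zero j, ?_⟩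
    · have h := hf t
      rw [evalScalar_eq_sum t q (B.coeff_curve_eq_zero hk1 hk hq), LinearMap.sum_apply,
        Finset.sum_eq_zero fun j _ => by rw [LinearMap.smul_apply, hz, smul_zero]] at h
      rw [← show 0 = f t from congrArg Prod.fst h, aff_zero, map_zero]
    · rw [hz, Prod.fst_zero, B.tangentOp_zero hk1 hk, coeff_zero]
  | succ d ih =>
    intro m hm hkm q hq f hf h0
    set a : A := (q.coeff m (0, 1)).1 with ha
    have hfil := hq m 0 (0, 1) trivial
    rw [zero_add, B.mem_fil p hm] at hfil
    have hqm : q.coeff m (0, 1) = (a, 0) := Prod.ext rfl hfil.2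
    set N := B.tangentOp p k a with hNdef
    have hN : N ∈ B.opFil p m := B.tangentOp_mem_opFil hk1 hk hm hfil.1
    have hN1 : N (0, 1) = (a, 0) := B.tangentOp_one hk1 hk a
    have hNk : N ^ k = 0 := B.tangentOp_pow_eq_zero hk1 hk a
    have hu : ∀ t : ZMod p, ∃ u, 1 + B.aff p u = evalScalar t (expPoly k m (-1 : ZMod p) N) := fun t => by
      rw [evalScalar_expPoly]
      exact B.exists_one_add_aff_eq_truncExp hk1 hk hkp a _
    choose u hu using hu
    -- Left multiplication by `exp (-t ^ m N)` stays in the group and cancels order `m` at the unit.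
    -- Although `1 + q` need not lie in the group, only its value at the unit matters here.
    obtain ⟨r, hr, hr1, hr2, -⟩ := ih (m + 1) (by omega) (by omega)
      (expPoly k m (-1 : ZMod p) N * (1 + q) - 1)
      (sub_mem (mul_mem (B.expPoly_mem_curves k _ hN) (add_mem (one_mem _) hq)) (one_mem _))
      (fun t => B.circ (u t) (f t)) (fun t => by
        have e1 : (1 + evalScalar t q) (0, 1) = (1 + B.aff p (f t)) (0, 1) := by
          rw [LinearMap.add_apply, LinearMap.add_apply, hf, aff_apply_one]
        rw [map_sub, map_mul, map_add, map_one, ← hu, LinearMap.sub_apply, Module.End.mul_apply,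
          e1, ← Module.End.mul_apply, ← one_add_aff_circ, LinearMap.add_apply,
          add_sub_cancel_left, aff_apply_one])
      (fun j hj => by
        rw [coeff_sub]
        rcases Nat.lt_succ_iff_lt_or_eq.1 hj with hj | rfl
        · rw [coeff_mul_of_lt (coeff_expPoly_zero hm _ hNk)
            (fun i hi him => coeff_expPoly_of_lt _ _ hi him) hj, coeff_add, add_sub_cancel_left,
            h0 j hj]
        · rw [coeff_mul_self hm (coeff_expPoly_zero hm _ hNk)
            (fun i hi him => coeff_expPoly_of_lt _ _ hi him), coeff_expPoly_self hm _ hNk,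
            coeff_add, coeff_add, coeff_one_zero, add_sub_right_comm, add_sub_cancel_left,
            LinearMap.add_apply, Module.End.mul_apply, LinearMap.add_apply, h0 0 hm, add_zero,
            LinearMap.smul_apply, Module.End.one_apply, hN1, hqm]
          simp)
    -- Multiplying back by `exp (t ^ m N)` restores `f` and puts `N` in degree `m`.
    refine ⟨expPoly k m (1 : ZMod p) N * (1 + r) - 1,
      sub_mem (mul_mem (B.expPoly_mem_curves k _ hN) (add_mem (one_mem _) hr)) (one_mem _),
      fun t => ?_, fun j hj => ?_, ?_⟩
    · rw [map_sub, map_mul, map_add, map_one, hr1, one_add_aff_circ, hu, ← mul_assoc,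
        evalScalar_expPoly, evalScalar_expPoly, one_mul, neg_one_mul, hNdef,
        B.truncExp_mul_truncExp_neg hk1 hk hkp, one_mul, add_sub_cancel_left]
    · rw [coeff_sub, coeff_mul_of_lt (coeff_expPoly_zero hm _ hNk)
        (fun i hi him => coeff_expPoly_of_lt _ _ hi him) hj, coeff_add, add_sub_cancel_left,
        hr2 j (by omega)]
    · rw [coeff_sub, coeff_mul_self hm (coeff_expPoly_zero hm _ hNk)
        (fun i hi him => coeff_expPoly_of_lt _ _ hi him), coeff_expPoly_self hm _ hNk, coeff_add,
        coeff_add, coeff_one_zero, hr2 0 (by omega), hr2 m (by omega), one_smul, add_zero, add_zero,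
        mul_one, add_sub_cancel_left]

/-- The lowest-order term of a curve in the group of the operators `1 + aff u`. -/
theorem coeff_eq_tangentOp {k : ℕ} (hk1 : 1 ≤ k) (hk : B.strongPow k = ⊥) (hkp : k < p) {m : ℕ}
    (hm : 1 ≤ m) {q : (Module.End (ZMod p) (A × ZMod p))[X]} (hq : q ∈ B.curves p)
    (hu : ∀ t : ZMod p, ∃ u, 1 + B.aff p u = evalScalar t q) (h0 : q.coeff 0 = 1)
    (h : ∀ j, 0 < j → j < m → q.coeff j = 0) :
    q.coeff m = B.tangentOp p k (q.coeff m (0, 1)).1 := by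
  rcases Nat.lt_or_ge m k with hmk | hmk
  swap
  · rw [B.coeff_curve_eq_zero hk1 hk hq m hmk, LinearMap.zero_apply, Prod.fst_zero,
      B.tangentOp_zero hk1 hk]
  choose u hu using hu
  have hq1 : q - 1 ∈ B.curves p := sub_mem hq (one_mem _)
  have hev : ∀ t, evalScalar t (q - 1) = B.aff p (u t) := fun t => by
    rw [map_sub, map_one, ← hu, add_sub_cancel_left]
  have hcm : (q - 1).coeff m = q.coeff m := by
    rw [coeff_sub, coeff_one, if_neg (by omega), sub_zero]
  obtain ⟨r, hr, hr1, -, hr2⟩ := B.exists_aff_curve hk1 hk hkp k m hm (by omega) (q - 1) hq1 u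
    (fun t => by rw [hev, aff_apply_one]) (fun j hj => by
      rcases Nat.eq_zero_or_pos j with rfl | hj0
      · rw [coeff_sub, h0, coeff_one_zero, sub_self, LinearMap.zero_apply]
      · rw [coeff_sub, h j hj0 hj, coeff_one, if_neg (by omega), sub_self, LinearMap.zero_apply])
  rw [hcm] at hr2
  rw [← hr2, ← hcm]
  -- `q - 1` and `r` agree at every `t` and have degree below `k`, hence have the same coefficients.
  refine ZMod.sum_pow_smul_injective hkp.le (c := (q - 1).coeff) (d := r.coeff) (fun t => ?_) hmk
  rw [← evalScalar_eq_sum t _ (B.coeff_curve_eq_zero hk1 hk hq1),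
    ← evalScalar_eq_sum t _ (B.coeff_curve_eq_zero hk1 hk hr), hev, hr1]

end LeftBrace

/-! ### The pre-Lie product. -/

open Polynomial in
theorem Polynomial.mul_coeff_two {R : Type*} [Semiring R] (q r : R[X]) :
    (q * r).coeff 2 = q.coeff 0 * r.coeff 2 + q.coeff 1 * r.coeff 1 + q.coeff 2 * r.coeff 0 := by
  rw [coeff_mul, Finset.Nat.sum_antidiagonal_eq_sum_range_succ_mk]
  simp [Finset.sum_range_succ]

/-- The quadratic coefficient of a commutator of exponentials. -/
theorem commutator_coeff_two {R : Type*} [Ring R] {M N m n : R} (hm : m + m = M * M)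
    (hn : n + n = N * N) :
    n + -M * -N + m + (N + M) * (-N + -M) + (n + M * N + m) = M * N - N * M := by
  have e : n + -M * -N + m + (N + M) * (-N + -M) + (n + M * N + m) =
      (m + m) + (n + n) + (M * N - N * M) - M * M - N * N := by noncomm_ring
  rw [e, hm, hn]
  abel

/-- Powers of two detect the linear term of a polynomial of small degree. -/
theorem ZMod.neg_sum_two_pow {p : ℕ} [Fact p.Prime] {k : ℕ} (hkp : 2 ^ k < p) {j : ℕ} (h1 : 1 ≤ j)
    (hj : j < k) :
    -∑ i ∈ Finset.range (p - 1), ((2 : ZMod p) ^ i)⁻¹ * (2 ^ i) ^ j = if j = 1 then 1 else 0 := by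
  have hp2 : 2 < p := lt_of_le_of_lt (by simpa using Nat.pow_le_pow_right two_pos (by omega : 1 ≤ k)) hkp
  have h2 : (2 : ZMod p) ≠ 0 := by
    intro h
    have : ((2 : ℕ) : ZMod p) = 0 := by exact_mod_cast h
    rw [ZMod.natCast_eq_zero_iff] at this
    exact absurd (Nat.le_of_dvd two_pos this) (by omega)
  obtain ⟨j, rfl⟩ := Nat.exists_eq_add_of_le' h1
  have e : ∀ i, ((2 : ZMod p) ^ i)⁻¹ * (2 ^ i) ^ (j + 1) = (2 ^ j) ^ i := fun i => by
    rw [pow_succ', ← mul_assoc, inv_mul_cancel₀ (pow_ne_zero i h2), one_mul, ← pow_mul, ← pow_mul,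
      mul_comm]
  -- A geometric sum of ratio `2 ^ j` (`j` now shifted by one): ratio `1` gives `-(p - 1) = 1`.
  -- Otherwise `2 ^ j < p` keeps the ratio from `1`, and Fermat makes the sum vanish.
  rw [Finset.sum_congr rfl fun i _ => e i]
  rcases Nat.eq_zero_or_pos j with rfl | hj0
  · simp [Nat.cast_sub (Fact.out : p.Prime).one_le]
  · rw [if_neg (by omega), neg_eq_zero]
    have hx : (2 : ZMod p) ^ j - 1 ≠ 0 := by
      rw [sub_ne_zero]
      intro h
      have h' : ((2 ^ j : ℕ) : ZMod p) = ((1 : ℕ) : ZMod p) := by exact_mod_cast h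
      have hlt : 2 ^ j < p := lt_trans (Nat.pow_lt_pow_right one_lt_two (by omega)) hkp
      rw [ZMod.natCast_eq_natCast_iff', Nat.mod_eq_of_lt hlt, Nat.mod_eq_of_lt (by omega)] at h'
      exact absurd h' (Nat.one_lt_two_pow (by omega)).ne'
    have := mul_geom_sum ((2 : ZMod p) ^ j) (p - 1)
    rw [ZMod.pow_card_sub_one_eq_one (pow_ne_zero j h2), sub_self] at this
    exact (mul_eq_zero.1 this).resolve_left hx

namespace LeftBrace

open Polynomial

variable {A : Type*} [AddCommGroup A] {p : ℕ} [Fact p.Prime] [Module (ZMod p) A] (B : LeftBrace A)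

theorem dot_eq_tangentOp {k : ℕ} (hk1 : 1 ≤ k) (hk : B.strongPow k = ⊥) (hkp : 2 ^ k < p) (a b : A) :
    B.dot p a b = (B.tangentOp p k a (b, 0)).1 := by
  -- `g` sends the unit to `a`, so `t g` realises the line `t ↦ t • a` as a curve.
  set g : Module.End (ZMod p) (A × ZMod p) := LinearMap.inl (ZMod p) A (ZMod p) ∘ₗ
    LinearMap.toSpanSingleton (ZMod p) A a ∘ₗ LinearMap.snd (ZMod p) A (ZMod p) with hg
  have hgx : ∀ x, g x = (x.2 • a, 0) := fun _ => rfl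
  have hgm : g ∈ B.opFil p 1 := by
    intro i x hx
    rw [hgx, B.mem_fil p (by omega)]
    refine ⟨?_, rfl⟩
    rcases Nat.eq_zero_or_pos i with rfl | hi
    · rw [zero_add, strongPow_one]; trivial
    · simp only
      rw [((B.mem_fil p hi).1 hx).2, zero_smul]; exact zero_mem _
  obtain ⟨r, hr, hr1, hr2, hr3⟩ := B.exists_aff_curve hk1 hk (Nat.lt_two_pow_self.trans hkp) k 1
    le_rfl (by omega) (monomial 1 g) (B.monomial_mem_curves hgm) (fun t => t • a)
    (fun t => by simp [evalScalar_monomial, hgx])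
    (fun j hj => by rw [coeff_monomial, if_neg (by omega), LinearMap.zero_apply])
  rw [coeff_monomial, if_pos rfl, hgx, one_smul] at hr3
  have hstar : ∀ t : ZMod p, B.star (t • a) b =
      ∑ j ∈ Finset.range k, t ^ j • (r.coeff j (b, 0)).1 := by
    intro t
    have h := congrArg Prod.fst (LinearMap.congr_fun (hr1 t) (b, 0))
    rw [evalScalar_eq_sum t r (B.coeff_curve_eq_zero hk1 hk hr), aff_apply, zero_smul, add_zero,
      LinearMap.sum_apply, Prod.fst_sum] at h
    exact h.symm
  have hcast : ∀ i : ℕ, (2 ^ i : ℕ) • a = ((2 : ZMod p) ^ i) • a := fun i => by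
    rw [← Nat.cast_smul_eq_nsmul (ZMod p)]; push_cast; rfl
  have hterm : B.dot p a b = ∑ j ∈ Finset.range k,
      (-∑ i ∈ Finset.range (p - 1), ((2 : ZMod p) ^ i)⁻¹ * (2 ^ i) ^ j) •
        (r.coeff j (b, 0)).1 := by
    rw [dot]
    simp only [hcast, hstar, Finset.smul_sum, smul_smul, neg_smul, Finset.sum_smul]
    rw [Finset.sum_comm, ← Finset.sum_neg_distrib]
  rw [hterm, ← hr3]
  have hz : ∀ j ∈ Finset.range k, (-∑ i ∈ Finset.range (p - 1), ((2 : ZMod p) ^ i)⁻¹ * (2 ^ i) ^ j) •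
        (r.coeff j (b, 0)).1 = if j = 1 then (r.coeff j (b, 0)).1 else 0 := by
    intro j hj
    rcases Nat.eq_zero_or_pos j with rfl | hj0
    · rw [hr2 0 one_pos]; simp
    · rw [ZMod.neg_sum_two_pow hkp hj0 (Finset.mem_range.1 hj)]
      split_ifs <;> simp
  rw [Finset.sum_congr rfl hz, Finset.sum_ite_eq']
  split_ifs with h1
  · rfl
  · rw [B.coeff_curve_eq_zero hk1 hk hr 1 (by simpa using h1)]; rfl

section Tangent

variable {k : ℕ} (hk1 : 1 ≤ k) (hk : B.strongPow k = ⊥) (hkp : k < p)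

include hk1 hk hkp

theorem exists_one_add_aff_eq_expPoly (a : A) (s t : ZMod p) :
    ∃ u, 1 + B.aff p u = evalScalar t (expPoly k 1 s (B.tangentOp p k a)) := by
  rw [evalScalar_expPoly]
  exact B.exists_one_add_aff_eq_truncExp hk1 hk hkp a _

/-- The linear coefficient of `exp (tM) exp (tN)` is `M + N`, with value `a + b` at the unit. -/
theorem tangentOp_add (a b : A) :
    B.tangentOp p k (a + b) = B.tangentOp p k a + B.tangentOp p k b := by
  have ha := B.tangentOp_pow_eq_zero (p := p) hk1 hk a
  have hb := B.tangentOp_pow_eq_zero (p := p) hk1 hk b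
  have hc : (expPoly k 1 (1 : ZMod p) (B.tangentOp p k a) *
      expPoly k 1 (1 : ZMod p) (B.tangentOp p k b)).coeff 1 =
      B.tangentOp p k a + B.tangentOp p k b := by
    rw [mul_coeff_one, coeff_expPoly_zero le_rfl _ ha, coeff_expPoly_zero le_rfl _ hb,
      coeff_expPoly_self le_rfl _ ha, coeff_expPoly_self le_rfl _ hb, one_smul, one_smul, one_mul,
      mul_one, add_comm]
  have h := B.coeff_eq_tangentOp hk1 hk hkp le_rfl
    (mul_mem (B.expPoly_mem_curves k (1 : ZMod p) (B.tangentOp_mem_opFil_one hk1 hk a))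
      (B.expPoly_mem_curves k (1 : ZMod p) (B.tangentOp_mem_opFil_one hk1 hk b)))
    (fun t => by
      obtain ⟨u, hu⟩ := B.exists_one_add_aff_eq_expPoly hk1 hk hkp a 1 t
      obtain ⟨v, hv⟩ := B.exists_one_add_aff_eq_expPoly hk1 hk hkp b 1 t
      exact ⟨B.circ u v, by rw [one_add_aff_circ, hu, hv, map_mul]⟩)
    (by rw [mul_coeff_zero, coeff_expPoly_zero le_rfl _ ha, coeff_expPoly_zero le_rfl _ hb, one_mul])
    (fun j hj hj1 => by omega)
  rw [hc, LinearMap.add_apply, B.tangentOp_one hk1 hk, B.tangentOp_one hk1 hk, Prod.mk_add_mk] at h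
  exact h.symm

/-- The group commutator of `exp (tM)` and `exp (-tM)`-type factors, `exp (tM) exp (tN) exp (-tM)
exp (-tN)`, has leading term `MN - NM` in degree two; `2 < p` allows the division by `2!`. -/
theorem tangentOp_commutator (hp : 2 < p) (a b : A) :
    B.tangentOp p k a * B.tangentOp p k b - B.tangentOp p k b * B.tangentOp p k a =
      B.tangentOp p k ((B.tangentOp p k a (b, 0)).1 - (B.tangentOp p k b (a, 0)).1) := by
  have ha := B.tangentOp_pow_eq_zero (p := p) hk1 hk a
  have hb := B.tangentOp_pow_eq_zero (p := p) hk1 hk b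
  have ham := B.tangentOp_mem_opFil_one (p := p) hk1 hk a
  have hbm := B.tangentOp_mem_opFil_one (p := p) hk1 hk b
  have ha1 := B.tangentOp_one (p := p) hk1 hk a
  have hb1 := B.tangentOp_one (p := p) hk1 hk b
  set M := B.tangentOp p k a
  set N := B.tangentOp p k b
  set q := expPoly k 1 (1 : ZMod p) M * expPoly k 1 (1 : ZMod p) N *
    (expPoly k 1 (-1 : ZMod p) M * expPoly k 1 (-1 : ZMod p) N) with hq
  have two_ne : (2 : ZMod p) ≠ 0 := by
    intro h
    have : ((2 : ℕ) : ZMod p) = 0 := by exact_mod_cast h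
    rw [ZMod.natCast_eq_zero_iff] at this
    exact absurd (Nat.le_of_dvd two_pos this) (by omega)
  have half : ∀ f : Module.End (ZMod p) (A × ZMod p),
      ((2 : ℕ) : ZMod p)⁻¹ • f ^ 2 + ((2 : ℕ) : ZMod p)⁻¹ • f ^ 2 = f * f := fun f => by
    rw [← two_smul (ZMod p), Nat.cast_two, smul_inv_smul₀ two_ne, sq]
  have c0 : ∀ (s : ZMod p) {f : Module.End (ZMod p) (A × ZMod p)}, f ^ k = 0 →
      (expPoly k 1 s f).coeff 0 = 1 := fun s f hf => coeff_expPoly_zero le_rfl s hf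
  have c1 : ∀ (s : ZMod p) {f : Module.End (ZMod p) (A × ZMod p)}, f ^ k = 0 →
      (expPoly k 1 s f).coeff 1 = s • f := fun s f hf => coeff_expPoly_self le_rfl s hf
  have c2 : ∀ (s : ZMod p) {f : Module.End (ZMod p) (A × ZMod p)}, f ^ k = 0 → s ^ 2 = 1 →
      (expPoly k 1 s f).coeff 2 = ((2 : ℕ) : ZMod p)⁻¹ • f ^ 2 := fun s f hf hs => by
    have := coeff_expPoly_mul (k := k) le_rfl s hf 2
    rwa [one_mul, hs, one_smul, Nat.factorial_two] at this
  have hs : (-1 : ZMod p) ^ 2 = 1 := by ring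
  have hneg : ∀ f : Module.End (ZMod p) (A × ZMod p), (-1 : ZMod p) • f = -f := fun f =>
    neg_one_smul (ZMod p) f
  have hq0 : q.coeff 0 = 1 := by
    simp only [hq, mul_coeff_zero, c0 _ ha, c0 _ hb, one_mul]
  have hq1 : q.coeff 1 = 0 := by
    simp only [hq, mul_coeff_zero, mul_coeff_one, c0 _ ha, c0 _ hb, c1 _ ha, c1 _ hb, one_mul,
      mul_one, one_smul, hneg]
    abel
  have hq2 : q.coeff 2 = M * N - N * M := by
    simp only [hq, mul_coeff_zero, mul_coeff_one, mul_coeff_two, c0 _ ha, c0 _ hb, c1 _ ha,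
      c1 _ hb, c2 _ ha (one_pow 2), c2 _ hb (one_pow 2), c2 _ ha hs, c2 _ hb hs, one_mul,
      mul_one, one_smul, hneg]
    exact commutator_coeff_two (half M) (half N)
  have h := B.coeff_eq_tangentOp hk1 hk hkp (m := 2) (by omega) (q := q)
    (mul_mem (mul_mem (B.expPoly_mem_curves k _ ham) (B.expPoly_mem_curves k _ hbm))
      (mul_mem (B.expPoly_mem_curves k _ ham) (B.expPoly_mem_curves k _ hbm)))
    (fun t => by
      obtain ⟨u, hu⟩ := B.exists_one_add_aff_eq_expPoly hk1 hk hkp a 1 t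
      obtain ⟨v, hv⟩ := B.exists_one_add_aff_eq_expPoly hk1 hk hkp b 1 t
      obtain ⟨u', hu'⟩ := B.exists_one_add_aff_eq_expPoly hk1 hk hkp a (-1) t
      obtain ⟨v', hv'⟩ := B.exists_one_add_aff_eq_expPoly hk1 hk hkp b (-1) t
      exact ⟨B.circ (B.circ u v) (B.circ u' v'), by
        rw [one_add_aff_circ, one_add_aff_circ, one_add_aff_circ, hu, hv, hu', hv', hq, map_mul,
          map_mul, map_mul]⟩)
    hq0 (fun j hj hj1 => by rw [show j = 1 by omega, hq1])
  rw [hq2, LinearMap.sub_apply, Module.End.mul_apply, Module.End.mul_apply, ha1, hb1,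
    Prod.fst_sub] at h
  exact h

end Tangent

/-- The pre-Lie algebra of a strongly nilpotent brace. -/
noncomputable def preLie {k : ℕ} (hk1 : 1 ≤ k) (hk : B.strongPow k = ⊥) (hkp : k < p) (hp : 2 < p) :
    PreLieStructure (ZMod p) A where
  mul := (AddMonoidHom.mk' (fun a => LinearMap.fst (ZMod p) A (ZMod p) ∘ₗ B.tangentOp p k a ∘ₗ
    LinearMap.inl (ZMod p) A (ZMod p)) fun a b => by
      rw [B.tangentOp_add hk1 hk hkp, LinearMap.add_comp, LinearMap.comp_add]).toZModLinearMap p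
  symm' x y z := by
    change (B.tangentOp p k (B.tangentOp p k x (y, 0)).1 (z, 0)).1 -
        (B.tangentOp p k x ((B.tangentOp p k y (z, 0)).1, 0)).1 =
      (B.tangentOp p k (B.tangentOp p k y (x, 0)).1 (z, 0)).1 -
        (B.tangentOp p k y ((B.tangentOp p k x (z, 0)).1, 0)).1
    have h := B.tangentOp_commutator hk1 hk hkp hp x y
    set u := (B.tangentOp p k x (y, 0)).1
    set v := (B.tangentOp p k y (x, 0)).1
    -- Applied to `z`, the relation between `[L_x, L_y]` and `L_{x·y - y·x}` is the pre-Lie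
    -- identity.
    have h2 := B.tangentOp_add hk1 hk hkp (u - v) v
    rw [sub_add_cancel, ← h] at h2
    have hx := B.apply_eq_of_mem_opFil_one (B.tangentOp_mem_opFil_one hk1 hk x) (z, (0 : ZMod p))
    have hy := B.apply_eq_of_mem_opFil_one (B.tangentOp_mem_opFil_one hk1 hk y) (z, (0 : ZMod p))
    rw [h2, ← hx, ← hy]
    simp only [LinearMap.add_apply, LinearMap.sub_apply, Module.End.mul_apply, Prod.fst_add,
      Prod.fst_sub]
    abel

end LeftBrace

/-! ### Spans of products in a pre-Lie algebra. -/

namespace PreLieStructure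

variable {F A : Type*} [Field F] [AddCommGroup A] [Module F A] {P : PreLieStructure F A}

theorem IsProduct.one_le {n : ℕ} {x : A} (h : P.IsProduct n x) : 1 ≤ n := by
  induction h with
  | single => exact le_rfl
  | mul _ _ h1 _ => omega

/-- An innermost product of two elements can be counted as one element. -/
theorem IsProduct.of_succ {n : ℕ} {x : A} (h : P.IsProduct (n + 1) x) (hn : 1 ≤ n) :
    P.IsProduct n x := by
  have key : ∀ N x, P.IsProduct N x → ∀ n, 1 ≤ n → N = n + 1 → P.IsProduct n x := by
    intro N x h
    induction h with
    | single a => intro n hn h; omega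
    | @mul i j a b ha hb iha ihb =>
      intro n hn h
      have hi := ha.one_le
      have hj := hb.one_le
      rcases Nat.lt_or_ge 1 i with h1 | h1
      · have := IsProduct.mul (iha (i - 1) (by omega) (by omega)) hb
        rwa [show i - 1 + j = n by omega] at this
      rcases Nat.lt_or_ge 1 j with h2 | h2
      · have := IsProduct.mul ha (ihb (j - 1) (by omega) (by omega))
        rwa [show i + (j - 1) = n by omega] at this
      · rw [show n = 1 by omega]
        exact IsProduct.single _
  exact key _ x h n hn rfl

variable (P) in
/-- The additive span of the products of `n` elements. -/
def productSpan (n : ℕ) : AddSubgroup A := AddSubgroup.closure {x | P.IsProduct n x}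

theorem productSpan_one : P.productSpan 1 = ⊤ :=
  top_unique fun x _ => AddSubgroup.subset_closure (IsProduct.single x)

theorem productSpan_le {i j : ℕ} (hi : 1 ≤ i) (hij : i ≤ j) :
    P.productSpan j ≤ P.productSpan i := by
  induction j, hij using Nat.le_induction with
  | base => exact le_rfl
  | succ j hj ih =>
    exact (AddSubgroup.closure_mono fun x hx => IsProduct.of_succ hx (hi.trans hj)).trans ih

theorem mul_mem_productSpan {i j : ℕ} {a b : A} (ha : a ∈ P.productSpan i)
    (hb : b ∈ P.productSpan j) : P.mul a b ∈ P.productSpan (i + j) := by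
  induction ha using AddSubgroup.closure_induction with
  | mem a ha =>
    induction hb using AddSubgroup.closure_induction with
    | mem b hb => exact AddSubgroup.subset_closure (IsProduct.mul ha hb)
    | zero => rw [map_zero]; exact zero_mem _
    | add x y _ _ hx hy => rw [map_add]; exact add_mem hx hy
    | neg x _ hx => rw [map_neg]; exact neg_mem hx
  | zero => rw [map_zero]; exact zero_mem _
  | add x y _ _ hx hy => rw [map_add]; exact add_mem hx hy
  | neg x _ hx => rw [map_neg]; exact neg_mem hx

theorem pow_succ_mem_productSpan {i j : ℕ} (hj : 1 ≤ j) {a b : A} (ha : a ∈ P.productSpan i)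
    (hb : b ∈ P.productSpan j) (n : ℕ) : (P.mul a ^ (n + 1)) b ∈ P.productSpan (i + j) := by
  have h : ∀ n, (P.mul a ^ n) b ∈ P.productSpan j := by
    intro n
    induction n with
    | zero => exact hb
    | succ n ih =>
      rw [pow_succ', Module.End.mul_apply]
      exact productSpan_le hj (by omega) (mul_mem_productSpan ha ih)
  rw [pow_succ', Module.End.mul_apply]
  exact mul_mem_productSpan ha (h n)

end PreLieStructure

/-! ### The group of flows and the nilpotency index. -/

namespace LeftBrace

variable {A : Type*} [AddCommGroup A] {p : ℕ} [Fact p.Prime] [Module (ZMod p) A] (B : LeftBrace A)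
  {k : ℕ} (hk1 : 1 ≤ k) (hk : B.strongPow k = ⊥) (hkp : k < p) (hp : 2 < p)

theorem preLie_mul (a b : A) :
    (B.preLie hk1 hk hkp hp).mul a b = (B.tangentOp p k a (b, 0)).1 := rfl

theorem tangentOp_pow_apply (a b : A) (n : ℕ) :
    (B.tangentOp p k a ^ n) (b, 0) = (((B.preLie hk1 hk hkp hp).mul a ^ n) b, 0) := by
  induction n with
  | zero => rfl
  | succ n ih =>
    rw [pow_succ', Module.End.mul_apply, ih, pow_succ', Module.End.mul_apply, preLie_mul]
    exact B.apply_eq_of_mem_opFil_one (B.tangentOp_mem_opFil_one hk1 hk a) _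

theorem circ_eq_expL (a b : A) :
    B.circ a b = a + (B.preLie hk1 hk hkp hp).expL k (B.logPoint p k a) b := by
  have h := congrArg Prod.fst
    (LinearMap.congr_fun (B.one_add_aff_eq_truncExp (p := p) hk1 hk hkp a) (b, 0))
  simp only [truncExp, LinearMap.add_apply, aff_apply, Module.End.one_apply, LinearMap.sum_apply,
    LinearMap.smul_apply, one_pow, one_smul, B.tangentOp_pow_apply hk1 hk hkp hp, Prod.fst_sum,
    Prod.fst_add, Prod.smul_fst, zero_smul, add_zero] at h
  rw [PreLieStructure.expL, ← h, circ_eq, add_assoc]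

theorem flowW_logPoint (a : A) :
    (B.preLie hk1 hk hkp hp).flowW k (B.logPoint p k a) = a := by
  have h := congrArg Prod.fst
    (LinearMap.congr_fun (B.one_add_aff_eq_truncExp (p := p) hk1 hk hkp a) (0, 1))
  set x := B.logPoint p k a
  -- The vanishing term `j = k` is added so that, once `j = 0` is split off, the range matches that
  -- of `flowW`.
  have e : truncExp k (1 : ZMod p) (B.tangentOp p k x) =
      ∑ j ∈ Finset.range (k + 1), ((j ! : ℕ) : ZMod p)⁻¹ • B.tangentOp p k x ^ j := by
    rw [Finset.sum_range_succ, B.tangentOp_pow_eq_zero hk1 hk, smul_zero, add_zero, truncExp]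
    simp only [one_pow, one_smul]
  rw [e, Finset.sum_range_succ'] at h
  simp only [pow_succ, LinearMap.add_apply, aff_apply_one, Module.End.one_apply,
    LinearMap.sum_apply, Module.End.mul_apply, B.tangentOp_one hk1 hk,
    LinearMap.smul_apply, B.tangentOp_pow_apply hk1 hk hkp hp, Prod.fst_sum, Prod.fst_add,
    Prod.smul_fst, pow_zero, smul_zero, add_zero, zero_add] at h
  exact h.symm

theorem isFlowMultiplication : (B.preLie hk1 hk hkp hp).IsFlowMultiplication k B.circ := by
  refine ⟨B.logPoint p k, fun x => ?_, B.flowW_logPoint hk1 hk hkp hp,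
    B.circ_eq_expL hk1 hk hkp hp⟩
  obtain ⟨a, rfl⟩ := (B.logPoint_bijective (p := p) hk1 hk).2 x
  rw [flowW_logPoint]

theorem mem_strongPow_of_isProduct {n : ℕ} {x : A}
    (h : (B.preLie hk1 hk hkp hp).IsProduct n x) : x ∈ B.strongPow n := by
  induction h with
  | single a => rw [strongPow_one]; trivial
  | @mul i j a b ha hb iha ihb =>
    have h := B.tangentOp_mem_opFil (p := p) hk1 hk ha.one_le iha j (b, 0)
      ((B.mem_fil p hb.one_le).2 ⟨ihb, rfl⟩)
    rw [B.mem_fil p (hb.one_le.trans (Nat.le_add_right _ _)), add_comm] at h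
    exact h.1

/-- Solving `W(x) = a` as `a` minus higher products of `x` improves the degree of `x` step by step
up to `i`. -/
theorem logPoint_mem_productSpan {i : ℕ} (hi : 1 ≤ i) {a : A}
    (ha : a ∈ (B.preLie hk1 hk hkp hp).productSpan i) :
    B.logPoint p k a ∈ (B.preLie hk1 hk hkp hp).productSpan i := by
  have hW := B.flowW_logPoint hk1 hk hkp hp a
  set x := B.logPoint p k a
  obtain ⟨n, rfl⟩ := Nat.exists_eq_add_of_le' hk1
  rw [PreLieStructure.flowW, Finset.sum_range_succ'] at hW
  have hx : x = a - ∑ j ∈ Finset.range n, (((j + 1 + 1)! : ℕ) : ZMod p)⁻¹ •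
      ((B.preLie hk1 hk hkp hp).mul x ^ (j + 1)) x := by
    rw [eq_sub_iff_add_eq, add_comm]
    simpa using hW
  have key : ∀ j, 1 ≤ j → j ≤ i → x ∈ (B.preLie hk1 hk hkp hp).productSpan j := by
    intro j hj
    induction j, hj using Nat.le_induction with
    | base => intro _; rw [PreLieStructure.productSpan_one]; trivial
    | succ j hj ih =>
      intro hji
      have h := ih (by omega)
      rw [hx]
      refine sub_mem (PreLieStructure.productSpan_le (by omega) hji ha) (sum_mem fun l _ => ?_)
      exact ZMod.smul_mem (PreLieStructure.productSpan_le (by omega) (by omega)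
        (PreLieStructure.pow_succ_mem_productSpan hj h h l)) _
  exact key i hi le_rfl

theorem strongPow_le_productSpan {n : ℕ} (hn : 1 ≤ n) :
    B.strongPow n ≤ (B.preLie hk1 hk hkp hp).productSpan n := by
  induction n using Nat.strong_induction_on with
  | _ n ih =>
    rcases Nat.lt_or_ge n 2 with h2 | h2
    · rw [show n = 1 by omega, PreLieStructure.productSpan_one]; exact le_top
    refine B.strongPow_le_of_star_mem h2 fun i j hi hj hij a ha b hb => ?_
    have hx := B.logPoint_mem_productSpan hk1 hk hkp hp hi (ih i (by omega) hi ha)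
    have hb' := ih j (by omega) hj hb
    have h := B.circ_eq_expL hk1 hk hkp hp a b
    set x := B.logPoint p k a
    obtain ⟨m, rfl⟩ := Nat.exists_eq_add_of_le' hk1
    -- Dropping the term `b` of the exponential writes `a * b` as a combination of iterated products
    -- `x · (⋯ (x · b))` with `x = Ω(a)`.
    have e : B.star a b = ∑ l ∈ Finset.range m, (((l + 1)! : ℕ) : ZMod p)⁻¹ •
        ((B.preLie hk1 hk hkp hp).mul x ^ (l + 1)) b := by
      rw [star, h, PreLieStructure.expL, Finset.sum_range_succ']
      simp
    rw [e, ← hij]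
    exact sum_mem fun l _ => ZMod.smul_mem
      (PreLieStructure.pow_succ_mem_productSpan hj hx hb' l) _

theorem preLie_isNilpotentOfIndex (h : B.IsStronglyNilpotentOfIndex k) :
    (B.preLie hk1 hk hkp hp).IsNilpotentOfIndex k := by
  refine ⟨⟨hk1, fun x hx => ?_⟩, fun n ⟨hn, hn0⟩ => h.2 ⟨hn, ?_⟩⟩
  · have := B.mem_strongPow_of_isProduct hk1 hk hkp hp hx
    rwa [hk, AddSubgroup.mem_bot] at this
  · exact bot_unique ((B.strongPow_le_productSpan hk1 hk hkp hp hn).trans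
      ((AddSubgroup.closure_le _).2 fun x hx => hn0 x hx))

end LeftBrace

theorem mainTheorem3 (p : ℕ) [Fact p.Prime] {A : Type*} [AddCommGroup A] [Module (ZMod p) A]
    (B : LeftBrace A) (hB : B.IsFBrace (ZMod p)) (k : ℕ)
    (hk : B.IsStronglyNilpotentOfIndex k) (hkp : 2 ^ k < p) :
    ∃ P : PreLieStructure (ZMod p) A,
      (∀ a b : A, P.mul a b = B.dot p a b) ∧
      P.IsNilpotentOfIndex k ∧
      P.IsFlowMultiplication k B.circ := by
  obtain ⟨hk1, hk0⟩ := hk.1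
  have hlt : k < p := Nat.lt_two_pow_self.trans hkp
  have hp : 2 < p := lt_of_le_of_lt (by simpa using Nat.pow_le_pow_right two_pos hk1) hkp
  exact ⟨B.preLie hk1 hk0 hlt hp, fun a b => (B.dot_eq_tangentOp hk1 hk0 hkp a b).symm,
    B.preLie_isNilpotentOfIndex hk1 hk0 hlt hp hk, B.isFlowMultiplication hk1 hk0 hlt hp⟩
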